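/- Let $\varphi\colon A\to B$ be a homomorphism of commutative rings with $1$. Call $\varphi$ *crisp* (also known as pure, or universally injective) if for every $A$-module $P$ the map $\varphi\otimes\mathrm{id}_P\colon A\otimes_A P\to B\otimes_A P$ is injective. Let $R$ be a commutative $A$-algebra (via any ring homomorphism $A\to R$). If $\varphi$ is crisp and $R\otimes_A B$ is integral over $B$ (via $b\mapsto 1\otimes b$), i.e. every element of $R\otimes_A B$ is a root of a monic polynomial with coefficients in $B$, then $R$ is integral over $A$. -/

import Mathlib

open scoped TensorProduct

universe u v w

/-- Let `A` be a commutative ring and `M`, `N` be `A`-modules. An `A`-linear map `f : M → N` is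
*crisp* (also called pure, or universally injective) if `f ⊗ id_P : M ⊗_A P → N ⊗_A P` is injective
for every `A`-module `P`.

The test modules `P` range over the universe of `A`. This is no restriction: every `A`-module is
the directed union of its finitely generated submodules, and these are, up to isomorphism, in the
universe of `A`. That a crisp map stays injective for test modules in an arbitrary universe is
proved in `LinearMap.IsCrisp.rTensor_injective`; see also `LinearMap.isCrisp_iff`. -/
def LinearMap.IsCrisp {A : Type u} [CommRing A] {M : Type v} {N : Type w}
    [AddCommGroup M] [Module A M] [AddCommGroup N] [Module A N] (f : M →ₗ[A] N) : Prop :=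
  ∀ (P : Type u) [AddCommGroup P] [Module A P], Function.Injective (f.rTensor P)

/-- A homomorphism of commutative rings `A → B` (given as an `A`-algebra `B`, the homomorphism
being `algebraMap A B`) is *crisp* if it is crisp as an `A`-linear map. -/
def Algebra.IsCrisp (A : Type u) (B : Type v) [CommRing A] [CommRing B] [Algebra A B] : Prop :=
  (Algebra.linearMap A B).IsCrisp

section UniverseIndependence

/-- A crisp map stays injective after tensoring with a module in an arbitrary universe. -/
theorem LinearMap.IsCrisp.rTensor_injective {A : Type u} [CommRing A] {M : Type v} {N : Type w}
    [AddCommGroup M] [Module A M] [AddCommGroup N] [Module A N] {f : M →ₗ[A] N} (hf : f.IsCrisp)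
    (P : Type*) [AddCommGroup P] [Module A P] : Function.Injective (f.rTensor P) := by
  rw [← LinearMap.lTensor_inj_iff_rTensor_inj]
  have key : ∀ Q : Submodule A P, Q.FG → Function.Injective (f.lTensor Q) := by
    intro Q hQ
    have : Small.{u} Q := Submodule.FG.small Q hQ
    rw [LinearMap.lTensor_inj_iff_rTensor_inj]
    let e : Shrink.{u} Q ≃ₗ[A] Q := Shrink.linearEquiv A Q
    have h1 := hf (Shrink.{u} Q)
    have hcomm : f.rTensor Q ∘ₗ (e.lTensor M).toLinearMap
        = (e.lTensor N).toLinearMap ∘ₗ f.rTensor (Shrink.{u} Q) := by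
      ext x y
      simp
    have h2 : Function.Injective (f.rTensor Q ∘ₗ (e.lTensor M).toLinearMap) := by
      rw [hcomm]
      exact (e.lTensor N).injective.comp h1
    intro x y hxy
    obtain ⟨x', rfl⟩ := (e.lTensor M).surjective x
    obtain ⟨y', rfl⟩ := (e.lTensor M).surjective y
    exact congrArg _ (h2 hxy)
  rw [injective_iff_map_eq_zero]
  intro t ht
  obtain ⟨Q, hQ, s, rfl⟩ := TensorProduct.exists_of_fg t
  have h0 : Q.subtype.rTensor N (f.lTensor Q s) = 0 := by
    rw [← ht]
    simp only [← LinearMap.comp_apply, LinearMap.rTensor_comp_lTensor,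
      LinearMap.lTensor_comp_rTensor]
  obtain ⟨Q', hle, hQ', h⟩ := TensorProduct.eq_zero_of_fg_of_subtype_eq_zero hQ h0
  have h1 : f.lTensor Q' ((Submodule.inclusion hle).rTensor M s) = 0 := by
    rw [← h]
    simp only [← LinearMap.comp_apply, LinearMap.rTensor_comp_lTensor,
      LinearMap.lTensor_comp_rTensor]
  have h2 := (injective_iff_map_eq_zero _).mp (key Q' hQ') _ h1
  rw [← Submodule.subtype_comp_inclusion _ _ hle, LinearMap.rTensor_comp, LinearMap.comp_apply, h2,
    map_zero]

/-- The definition of crispness does not depend on the universe of the test modules, as long as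
that universe contains (copies of) the modules in the universe of `A`. -/
theorem LinearMap.isCrisp_iff {A : Type u} [CommRing A] {M : Type v} {N : Type w}
    [AddCommGroup M] [Module A M] [AddCommGroup N] [Module A N] {f : M →ₗ[A] N} :
    f.IsCrisp ↔ ∀ (P : Type (max u v w)) [AddCommGroup P] [Module A P],
      Function.Injective (f.rTensor P) := by
  refine ⟨fun hf P _ _ => hf.rTensor_injective P, fun h P _ _ => ?_⟩
  let e : ULift.{max v w} P ≃ₗ[A] P := ULift.moduleEquiv
  have hcomm : f.rTensor P ∘ₗ (e.lTensor M).toLinearMap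
      = (e.lTensor N).toLinearMap ∘ₗ f.rTensor (ULift.{max v w} P) := by
    ext x y
    simp
  have h2 : Function.Injective (f.rTensor P ∘ₗ (e.lTensor M).toLinearMap) := by
    rw [hcomm]
    exact (e.lTensor N).injective.comp (h _)
  intro x y hxy
  obtain ⟨x', rfl⟩ := (e.lTensor M).surjective x
  obtain ⟨y', rfl⟩ := (e.lTensor M).surjective y
  exact congrArg _ (h2 hxy)

end UniverseIndependence

/-! An element `r` of an algebra is integral if and only if some power `r ^ n` lies in the span `N`
of the lower powers. The formation of `N` commutes with base change to `B`, and crispness tested on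
the module `R ⧸ N` says that `N` is the contraction to `R` of its extension to `B ⊗[A] R`. -/

theorem isIntegral_iff_exists_pow_mem_span {A R : Type*} [CommRing A] [Ring R] [Algebra A R]
    {r : R} :
    IsIntegral A r ↔
      ∃ n : ℕ, r ^ n ∈ Submodule.span A (Set.range fun i : Fin n => r ^ (i : ℕ)) := by
  constructor
  · rintro ⟨p, hp, hpr⟩
    refine ⟨p.natDegree, ?_⟩
    have hpow : r ^ p.natDegree = -∑ i ∈ Finset.range p.natDegree, p.coeff i • r ^ i := by
      rw [← Polynomial.aeval_def, Polynomial.aeval_eq_sum_range, Finset.sum_range_succ,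
        hp.coeff_natDegree, one_smul] at hpr
      exact eq_neg_of_add_eq_zero_right hpr
    rw [hpow]
    exact neg_mem <| sum_mem fun i hi => Submodule.smul_mem _ _ <|
      Submodule.subset_span ⟨⟨i, Finset.mem_range.mp hi⟩, rfl⟩
  · rintro ⟨n, hn⟩
    obtain ⟨q, hq, hqr⟩ := PowerBasis.mem_span_pow'.mp hn
    exact ⟨.X ^ n - q, Polynomial.monic_X_pow_sub hq, by simp [← Polynomial.aeval_def, hqr]⟩

namespace Algebra.IsCrisp

variable {A : Type u} {B : Type v} [CommRing A] [CommRing B] [Algebra A B]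

theorem mk_one_injective (hB : Algebra.IsCrisp A B) (M : Type*) [AddCommGroup M] [Module A M] :
    Function.Injective (TensorProduct.mk A B M 1) := by
  have hcomp : TensorProduct.mk A B M 1 =
      (Algebra.linearMap A B).rTensor M ∘ₗ (_root_.TensorProduct.lid A M).symm.toLinearMap := by
    ext x
    simp
  rw [hcomp]
  exact (LinearMap.IsCrisp.rTensor_injective hB M).comp
    (_root_.TensorProduct.lid A M).symm.injective

theorem one_tmul_mem_baseChange_iff (hB : Algebra.IsCrisp A B) {M : Type*} [AddCommGroup M]
    [Module A M] {N : Submodule A M} {x : M} :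
    (1 : B) ⊗ₜ[A] x ∈ N.baseChange B ↔ x ∈ N := by
  refine ⟨fun hx => ?_, Submodule.tmul_mem_baseChange_of_mem 1⟩
  have hker : (1 : B) ⊗ₜ[A] x ∈ LinearMap.ker (N.mkQ.lTensor B) := by
    rw [lTensor_mkQ]
    exact hx
  have hmk : (1 : B) ⊗ₜ[A] N.mkQ x = (1 : B) ⊗ₜ[A] (0 : M ⧸ N) := by
    rw [TensorProduct.tmul_zero]
    exact hker
  exact (Submodule.Quotient.mk_eq_zero N).mp (hB.mk_one_injective (M ⧸ N) hmk)

theorem isIntegral_of_one_tmul (hB : Algebra.IsCrisp A B) {R : Type*} [Ring R] [Algebra A R]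
    {r : R} (hr : IsIntegral B ((1 : B) ⊗ₜ[A] r)) : IsIntegral A r := by
  obtain ⟨n, hn⟩ := isIntegral_iff_exists_pow_mem_span.mp hr
  refine isIntegral_iff_exists_pow_mem_span.mpr ⟨n, hB.one_tmul_mem_baseChange_iff.mp ?_⟩
  simpa [← Set.range_comp, Function.comp_def] using hn

end Algebra.IsCrisp

theorem proposition1p10_general {A : Type u} {B : Type v} {R : Type w}
    [CommRing A] [CommRing B] [Ring R] [Algebra A B] [Algebra A R]
    (hB : Algebra.IsCrisp A B)
    (hR : (Algebra.TensorProduct.includeRight : B →ₐ[A] R ⊗[A] B).toRingHom.IsIntegral) :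
    Algebra.IsIntegral A R := by
  refine ⟨fun r => ?_⟩
  have hr : IsIntegral B ((1 : B) ⊗ₜ[A] r) :=
    (hR (r ⊗ₜ[A] 1)).map (Algebra.TensorProduct.comm A R B).toRingHom
  exact hB.isIntegral_of_one_tmul hr

theorem proposition1p10 {A : Type u} {B : Type v} {R : Type w}
    [CommRing A] [CommRing B] [CommRing R] [Algebra A B] [Algebra A R]
    (hB : Algebra.IsCrisp A B)
    (hR : (Algebra.TensorProduct.includeRight : B →ₐ[A] R ⊗[A] B).toRingHom.IsIntegral) :
    Algebra.IsIntegral A R :=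
  proposition1p10_general hB hR
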